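/- Let $(V,\omega)$ be a finite-dimensional symplectic vector space over an arbitrary field $\mathbb{K}$ (that is, $\omega$ is an alternating, non-degenerate bilinear form on $V$), and write $\dim_{\mathbb K}V=2n$. For $M\in\operatorname{End}(V)$ let $M^{*\omega}$ be the symplectic adjoint, determined by $\omega(Mv,w)=\omega(v,M^{*\omega}w)$ for all $v,w\in V$, and let $E$ be the identity map. If $A$ is an endomorphism of a symplectic space $(V,\omega)$ such that $\omega_A(v,w)=\omega(v,Aw)$ is alternating, let $\psi_A(t)$ be the Pfaffian of the matrix of $\omega_{A-tE}$ with respect to $(e_1,f_1,\dots,e_n,f_n)$, where $(e_1,\dots,e_n,f_1,\dots,f_n)$ is a symplectic basis, i.e. $\omega(e_i,e_j)=\omega(f_i,f_j)=0$, $\omega(e_i,f_j)=\delta_{ij}$ (this does not depend on the choice of that basis). The symplectic characteristic polynomial of $M$ is $\chi^\omega_M(s,t)=\psi_{(M-sE)(M^{*\omega}-sE)}(t)$, where $(M-sE)(M^{*\omega}-sE)$ is regarded as an endomorphism of $V\otimes_{\mathbb K}\mathbb K(s)$ with the extended form $\omega$. For $M,N\in\operatorname{End}(V)$ and $\lambda,\mu\in\mathbb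 K$ put $G_M(\lambda)=\ker (M-\lambda E)^{\dim V}$ and $$G_{M,N}(\lambda,\mu)=\bigl(G_M(\lambda)\cap G_N(\mu)\bigr)+\bigl(G_M(\mu)\cap G_N(\lambda)\bigr).$$ For a subspace $W\subset V$ put $W^{\perp\omega}=\{v\in V:\omega(v,w)=0\ \forall w\in W\}$; $W$ is called symplectic if $W\cap W^{\perp\omega}=\{0\}$. Let $M\in\operatorname{End}(V)$ satisfy $MM^{*\omega}=M^{*\omega}M$, and suppose that $$\chi^\omega_M(s,t)=\prod_{i=1}^k\{(\lambda_i-s)(\mu_i-s)-t\}^{m_i},\qquad \lambda_i,\mu_i\in\mathbb K,$$ with integers $m_i\ge 0$ and with $(\lambda_i-s)(\mu_i-s)\neq(\lambda_j-s)(\mu_j-s)$ as polynomials in $s$ for $i\neq j$. Then: 1. $\dim_{\mathbb K}G_{M,M^{*\omega}}(\lambda_i,\mu_i)=2m_i$ for every $i$; 2. $V=\bigoplus_{i=1}^k G_{M,M^{*\omega}}(\lambda_i,\mu_i)$; 3. $G_{M,M^{*\omega}}(\lambda_i,\mu_i)\subset \bigl(G_{M,M^{*\omega}}(\lambda_j,\mu_j)\bigr)^{\perp\omega}$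 for $i\neq j$; 4. every $G_{M,M^{*\omega}}(\lambda_i,\mu_i)$ is invariant under $M$ and under $M^{*\omega}$ and is a symplectic subspace of $(V,\omega)$. -/

import Mathlib

open scoped TensorProduct

namespace SymplecticCharPoly

section

variable {K : Type*} [Field K] {V : Type*} [AddCommGroup V] [Module K V]

/-- A symplectic form: alternating and non-degenerate. -/
structure IsSymplectic (ω : LinearMap.BilinForm K V) : Prop where
  isAlt : ω.IsAlt
  nondegenerate : ω.Nondegenerate

/-- A symplectic basis `(e₁, …, eₙ, f₁, …, fₙ)`; here `e i = b (Sum.inl i)`, `f i = b (Sum.inr i)`. -/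
structure IsSymplecticBasis (ω : LinearMap.BilinForm K V) {n : ℕ}
    (b : Module.Basis (Fin n ⊕ Fin n) K V) : Prop where
  inl_inl : ∀ i j, ω (b (Sum.inl i)) (b (Sum.inl j)) = 0
  inr_inr : ∀ i j, ω (b (Sum.inr i)) (b (Sum.inr j)) = 0
  inl_inr : ∀ i j, ω (b (Sum.inl i)) (b (Sum.inr j)) = if i = j then 1 else 0

theorem linearIndependent_of_pairing (ω : LinearMap.BilinForm K V) {n : ℕ} (v : Fin n ⊕ Fin n → V)
    (h1 : ∀ i j, ω (v (Sum.inl i)) (v (Sum.inl j)) = 0)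
    (h2 : ∀ i j, ω (v (Sum.inr i)) (v (Sum.inr j)) = 0)
    (h3 : ∀ i j, ω (v (Sum.inl i)) (v (Sum.inr j)) = if i = j then 1 else 0) :
    LinearIndependent K v := by
  rw [Fintype.linearIndependent_iff]
  intro g hg
  rw [Fintype.sum_sum_type] at hg
  rintro (j | j)
  · have := congrArg (fun x => ω x (v (Sum.inr j))) hg
    simpa [h2, h3] using this
  · have := congrArg (fun x => ω (v (Sum.inl j)) x) hg
    simpa [h1, h3] using this

/-- Every finite-dimensional symplectic vector space has a symplectic basis. -/
theorem IsSymplectic.exists_basis [FiniteDimensional K V] {ω : LinearMap.BilinForm K V}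
    (hω : IsSymplectic ω) :
    ∃ (n : ℕ) (b : Module.Basis (Fin n ⊕ Fin n) K V), IsSymplecticBasis ω b := by
  by_contra hno
  have key : ∀ n : ℕ, ∃ v : Fin n ⊕ Fin n → V,
      (∀ i j, ω (v (Sum.inl i)) (v (Sum.inl j)) = 0) ∧
      (∀ i j, ω (v (Sum.inr i)) (v (Sum.inr j)) = 0) ∧
      (∀ i j, ω (v (Sum.inl i)) (v (Sum.inr j)) = if i = j then 1 else 0) := by
    intro n
    induction n with
    | zero => exact ⟨fun _ => 0, by simp, by simp, fun i => i.elim0⟩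
    | succ n ih =>
      obtain ⟨v, h1, h2, h3⟩ := ih
      have hli := linearIndependent_of_pairing ω v h1 h2 h3
      have h4 : ∀ i j, ω (v (Sum.inr i)) (v (Sum.inl j)) = - if i = j then 1 else 0 := by
        intro i j
        rw [← hω.isAlt.neg_eq, h3]
        simp [eq_comm]
      have hspan : ¬ (⊤ ≤ Submodule.span K (Set.range v)) := fun h =>
        hno ⟨n, Module.Basis.mk hli h, by
          constructor <;> intro i j <;> simp only [Module.Basis.mk_apply, h1, h2, h3]⟩
      obtain ⟨x, -, hx⟩ := SetLike.not_le_iff_exists.mp hspan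
      -- the projection onto the symplectic complement of the span of `v`
      let pr : V → V := fun y => y - ∑ i, ω y (v (Sum.inr i)) • v (Sum.inl i)
        + ∑ i, ω y (v (Sum.inl i)) • v (Sum.inr i)
      have prl : ∀ y j, ω (pr y) (v (Sum.inl j)) = 0 := by
        intro y j
        simp [pr, h1, h4]
      have prr : ∀ y j, ω (pr y) (v (Sum.inr j)) = 0 := by
        intro y j
        simp [pr, h2, h3]
      have prl' : ∀ y j, ω (v (Sum.inl j)) (pr y) = 0 := fun y j =>
        hω.isAlt.isRefl _ _ (prl y j)
      have prr' : ∀ y j, ω (v (Sum.inr j)) (pr y) = 0 := fun y j =>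
        hω.isAlt.isRefl _ _ (prr y j)
      have hx0 : pr x ≠ 0 := by
        intro h0
        apply hx
        have hxe : x = ∑ i, ω x (v (Sum.inr i)) • v (Sum.inl i)
            - ∑ i, ω x (v (Sum.inl i)) • v (Sum.inr i) := by
          have : x - (∑ i, ω x (v (Sum.inr i)) • v (Sum.inl i)
            - ∑ i, ω x (v (Sum.inl i)) • v (Sum.inr i)) = 0 := by
            rw [← h0]; simp only [pr]; abel
          exact sub_eq_zero.mp this
        rw [hxe]
        refine Submodule.sub_mem _ ?_ ?_ <;>
        · refine Submodule.sum_mem _ fun i _ => Submodule.smul_mem _ _ ?_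
          exact Submodule.subset_span ⟨_, rfl⟩
      have hy : ∃ y, ω (pr x) y ≠ 0 := by
        by_contra! hy
        exact hx0 (hω.nondegenerate.1 _ hy)
      obtain ⟨y, hy⟩ := hy
      have hpair : ω (pr x) (pr y) = ω (pr x) y := by
        conv_lhs => arg 2; simp only [pr]
        simp [prl, prr]
      let y' := (ω (pr x) y)⁻¹ • pr y
      refine ⟨Sum.elim (Fin.cons (pr x) fun i => v (Sum.inl i))
        (Fin.cons y' fun i => v (Sum.inr i)), ?_, ?_, ?_⟩
      · intro i j
        refine Fin.cases ?_ (fun i => ?_) i <;> refine Fin.cases ?_ (fun j => ?_) j <;>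
          simp [h1, prl, prl', hω.isAlt.self_eq_zero]
      · intro i j
        refine Fin.cases ?_ (fun i => ?_) i <;> refine Fin.cases ?_ (fun j => ?_) j <;>
          simp [y', h2, prr, prr', hω.isAlt.self_eq_zero]
      · intro i j
        refine Fin.cases ?_ (fun i => ?_) i <;> refine Fin.cases ?_ (fun j => ?_) j
        · simp [y', hpair, hy]
        · simp [prr, (Fin.succ_ne_zero _).symm]
        · simp [y', prl', Fin.succ_ne_zero]
        · simp [h3]
  obtain ⟨v, h1, h2, h3⟩ := key (Module.finrank K V + 1)
  have := (linearIndependent_of_pairing ω v h1 h2 h3).fintype_card_le_finrank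
  simp at this
  omega

/-- Extension of scalars of a symplectic form is symplectic. -/
theorem IsSymplectic.baseChange [FiniteDimensional K V] {ω : LinearMap.BilinForm K V}
    (hω : IsSymplectic ω) (F : Type*) [Field F] [Algebra K F] :
    IsSymplectic (ω.baseChange F) := by
  have hskew : ∀ x y : F ⊗[K] V, ω.baseChange F x y + ω.baseChange F y x = 0 := by
    intro x y
    induction x using TensorProduct.induction_on with
    | zero => simp
    | add x x' hx hx' =>
      simp only [map_add, LinearMap.add_apply]
      linear_combination hx + hx'
    | tmul a v =>
      induction y using TensorProduct.induction_on with
      | zero => simp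
      | add y y' hy hy' =>
        simp only [map_add, LinearMap.add_apply]
        linear_combination hy + hy'
      | tmul c w =>
        simp only [LinearMap.BilinForm.baseChange_tmul]
        rw [← hω.isAlt.neg_eq v w, mul_comm c a, neg_smul, add_neg_cancel]
  refine ⟨fun x => ?_, ?_⟩
  · induction x using TensorProduct.induction_on with
    | zero => simp
    | add x y hx hy =>
      simp only [map_add, LinearMap.add_apply]
      linear_combination hx + hy + hskew x y
    | tmul a v => simp [hω.isAlt.self_eq_zero]
  · classical
    let b := Module.finBasis K V
    have hm : LinearMap.BilinForm.toMatrix (b.baseChange F) (ω.baseChange F)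
        = (LinearMap.BilinForm.toMatrix b ω).map (algebraMap K F) := by
      ext i j
      simp [LinearMap.BilinForm.toMatrix_apply, Algebra.smul_def]
    rw [LinearMap.BilinForm.nondegenerate_iff_det_ne_zero (b := b.baseChange F), hm,
      ← RingHom.mapMatrix_apply, ← RingHom.map_det]
    have := (LinearMap.BilinForm.nondegenerate_iff_det_ne_zero b).mp hω.nondegenerate
    simpa using this

/-- The linear isomorphism `ω♭ : V ≃ V*`, `v ↦ ω(·, v)`. -/
noncomputable def flat [FiniteDimensional K V] {ω : LinearMap.BilinForm K V}
    (hω : IsSymplectic ω) : V ≃ₗ[K] Module.Dual K V :=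
  ω.flip.toDual hω.nondegenerate.flip

theorem flat_apply [FiniteDimensional K V] {ω : LinearMap.BilinForm K V}
    (hω : IsSymplectic ω) (v w : V) : flat hω v w = ω w v := rfl

/-- The symplectic adjoint `M^{*ω} = (ω♭)⁻¹ ∘ M* ∘ ω♭`, where `M*` is the dual map of `M`. -/
noncomputable def sympAdjoint [FiniteDimensional K V] {ω : LinearMap.BilinForm K V}
    (hω : IsSymplectic ω) (M : Module.End K V) : Module.End K V :=
  (flat hω).symm.toLinearMap ∘ₗ M.dualMap ∘ₗ (flat hω).toLinearMap

/-- `ω(M v, w) = ω(v, M^{*ω} w)`. -/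
theorem apply_sympAdjoint [FiniteDimensional K V] {ω : LinearMap.BilinForm K V}
    (hω : IsSymplectic ω) (M : Module.End K V) (v w : V) :
    ω v (sympAdjoint hω M w) = ω (M v) w := by
  rw [← flat_apply hω]
  simp [sympAdjoint, flat_apply]

/-- The symplectically orthogonal subspace `W^{⊥ω} = {v | ∀ w ∈ W, ω(v, w) = 0}`. -/
def sympOrthogonal (ω : LinearMap.BilinForm K V) (W : Submodule K V) : Submodule K V :=
  ω.flip.orthogonal W

theorem mem_sympOrthogonal (ω : LinearMap.BilinForm K V) (W : Submodule K V) (v : V) :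
    v ∈ sympOrthogonal ω W ↔ ∀ w ∈ W, ω v w = 0 := Iff.rfl

/-- A subspace `W` is symplectic if `W ∩ W^{⊥ω} = {0}`. -/
def IsSymplecticSubspace (ω : LinearMap.BilinForm K V) (W : Submodule K V) : Prop :=
  W ⊓ sympOrthogonal ω W = ⊥

/-- `G_{M,N}(l, m) = (G_M(l) ∩ G_N(m)) + (G_M(m) ∩ G_N(l))`, where
`G_M(l) = ker (M - l E) ^ dim V`. -/
noncomputable def pairGenEigenspace (M N : Module.End K V) (l m : K) : Submodule K V :=
  (M.genEigenspace l (Module.finrank K V) ⊓ N.genEigenspace m (Module.finrank K V)) ⊔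
  (M.genEigenspace m (Module.finrank K V) ⊓ N.genEigenspace l (Module.finrank K V))

end

/-- The Pfaffian of an alternating matrix of order `2 n`, by expansion along the first row:
`Pf A = ∑_{j = 2}^{2n} (-1)^j a_{1j} Pf A_{1j}`, where `A_{1j}` is `A` without the rows and columns
`1` and `j`. It is defined over any commutative ring, with no division. (Indices start at `0` below:
the column `j.succ` is the column of number `j + 2` in the formula.) -/
def pfaffian {R : Type*} [CommRing R] : (n : ℕ) → Matrix (Fin (2 * n)) (Fin (2 * n)) R → R
  | 0, _ => 1
  | n + 1, A => ∑ j : Fin (2 * n + 1), (-1) ^ (j : ℕ) * A 0 j.succ *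
      pfaffian n (A.submatrix (fun i => (j.succAbove i).succ) (fun i => (j.succAbove i).succ))

/-- Rearranges `(e₁, …, eₙ, f₁, …, fₙ)` as `(e₁, f₁, …, eₙ, fₙ)`. -/
def interleave {V : Type*} {n : ℕ} (v : Fin n ⊕ Fin n → V) (i : Fin (2 * n)) : V :=
  if (i : ℕ) % 2 = 0 then v (Sum.inl ⟨i / 2, by omega⟩) else v (Sum.inr ⟨i / 2, by omega⟩)

section

variable {K : Type*} [Field K] {V : Type*} [AddCommGroup V] [Module K V]

/-- For `A ∈ End V` such that `ω_A(v, w) = ω(v, A w)` is alternating, the polynomial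
`ψ_A(t) = Pf_ω(ω_{A - t E})`, the Pfaffian of the matrix of `ω_{A - t E}` with respect to
`(e₁, f₁, …, eₙ, fₙ)` for a symplectic basis `(e₁, …, eₙ, f₁, …, fₙ)`; it does not depend on that
basis, because automorphisms that preserve `ω` have determinant `1`. -/
noncomputable def rootPoly [FiniteDimensional K V] {ω : LinearMap.BilinForm K V}
    (hω : IsSymplectic ω) (A : Module.End K V) : Polynomial K :=
  let v := interleave hω.exists_basis.choose_spec.choose
  pfaffian hω.exists_basis.choose (Matrix.of fun i j =>
    Polynomial.C (ω (v i) (A (v j))) - Polynomial.X * Polynomial.C (ω (v i) (v j)))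

/-- The endomorphism `(M - s E) (M^{*ω} - s E)` of the extension of `V` to the field `K(s)` of
rational functions; the variable `s` is `RatFunc.X`. -/
noncomputable def shiftedProduct [FiniteDimensional K V] {ω : LinearMap.BilinForm K V}
    (hω : IsSymplectic ω) (M : Module.End K V) : Module.End (RatFunc K) (RatFunc K ⊗[K] V) :=
  (M.baseChange (RatFunc K) - (RatFunc.X : RatFunc K) • 1) *
    ((sympAdjoint hω M).baseChange (RatFunc K) - (RatFunc.X : RatFunc K) • 1)

/-- The symplectic characteristic polynomial, a polynomial in `t = Polynomial.X` over `K(s)`. -/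
noncomputable def sympCharPoly [FiniteDimensional K V] {ω : LinearMap.BilinForm K V}
    (hω : IsSymplectic ω) (M : Module.End K V) : Polynomial (RatFunc K) :=
  rootPoly (hω.baseChange (RatFunc K)) (shiftedProduct hω M)

end

end SymplecticCharPoly

open SymplecticCharPoly

/-!
The determinant `det ((M - s)(M^{*ω} - s) - t)` is the square of `χ^ω_M(s, t)`. So the hypothesis
says that the characteristic polynomial of the endomorphism `A = (M - s)(M^{*ω} - s)` over `K(s)`
(`shiftedProduct`) is `∏ (t - r_i)^{2 m_i}`, for the pairwise distinct `r_i = (λ_i - s)(μ_i - s)`.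

The identity `Pf² = det` is proved without permutation sums. For an alternating form `B`, the
Pfaffian of the Gram matrix of `v₁, …, v_{2n}` is the value at `v₁ ∧ ⋯ ∧ v_{2n}` of a fixed linear
functional on the exterior algebra: pass to the Clifford algebra of the zero form by the change of
form along `-B`, then take the scalar part (`wickFunctional_ιMulti`). The Pfaffian is therefore an
alternating function of the vectors, so a change of basis multiplies it by the determinant
(`pfaffian_gram`). As the determinant of the Gram matrix is multiplied by the square, it is enough
to look at a symplectic basis, which exists when `B` is non-degenerate. This is enough, because the
matrix of `ω_{A - tE}` has determinant the characteristic polynomial of `A`, which is not zero.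

Setting `t = 0` in `χ^ω_M(s, t)²` shows that the characteristic polynomials of `M` and `M^{*ω}`
split, so `V` is the sum of the spaces `G_M(a) ∩ G_{M^{*ω}}(b)`. The extension of such a space to
`K(s)` lies in the generalized eigenspace of `A` for `(a - s)(b - s)`, since this product and `A`
differ by a sum of commuting endomorphisms that are nilpotent there. If the space is not zero, then
`(a - s)(b - s)` is some `r_i`, and `{a, b} = {λ_i, μ_i}` since `a, b` are its roots. Hence the
spaces `G(λ_i, μ_i)` span `V` and have dimension at most `2 m_i`.

By the adjunction, `G_M(a)` and `G_{M^{*ω}}(b)` are orthogonal when `a ≠ b`, which gives the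
orthogonality of the `G(λ_i, μ_i)`. Subspaces that span `V` and are pairwise orthogonal are
symplectic, as `ω` is non-degenerate, and therefore independent. The sum is direct, and comparing
`∑ dim G(λ_i, μ_i) = dim V = ∑ 2 m_i` turns the bounds on the dimensions into equalities.
-/

namespace SymplecticCharPoly

/-! ### The Pfaffian as a functional on the exterior algebra -/

open CliffordAlgebra in
/-- Contraction is an antiderivation: the Laplace-type expansion of `d ⌋ (v₀ ∧ ⋯ ∧ vₙ)`. -/
theorem contractLeft_ιMulti_succ {R M : Type*} [CommRing R] [AddCommGroup M] [Module R M]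
    (d : Module.Dual R M) (n : ℕ) (v : Fin (n + 1) → M) :
    contractLeft (Q := (0 : QuadraticForm R M)) d (ExteriorAlgebra.ιMulti R (n + 1) v) =
      ∑ j : Fin (n + 1), ((-1) ^ (j : ℕ) * d (v j)) •
        ExteriorAlgebra.ιMulti R n (fun i => v (j.succAbove i)) := by
  induction n with
  | zero =>
    rw [ExteriorAlgebra.ιMulti_succ_apply]
    erw [contractLeft_ι_mul]
    simp [contractLeft_one]
  | succ n ih =>
    rw [ExteriorAlgebra.ιMulti_succ_apply]
    erw [contractLeft_ι_mul]
    rw [ih]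
    conv_rhs => rw [Fin.sum_univ_succ]
    rw [Finset.mul_sum, sub_eq_add_neg, ← Finset.sum_neg_distrib]
    congr 1
    · simp [Matrix.vecTail, Function.comp_def]
    · refine Finset.sum_congr rfl fun j _ => ?_
      rw [ExteriorAlgebra.ιMulti_succ_apply, mul_smul_comm, ← neg_smul]
      congr 1
      · simp [Matrix.vecTail, pow_succ]
      · change ExteriorAlgebra.ι R (v 0) * _ = _
        simp [Matrix.vecTail, Function.comp_def]

/-- The linear functional on the exterior algebra given by the alternating form `B`: the exterior
algebra is the Clifford algebra of the zero quadratic form, which the change of form along `-B`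
maps to itself because `B` is alternating; then the scalar part is taken. The sign of `-B` makes the
value at `x ∧ y` equal to `B x y`. -/
noncomputable def wickFunctional {R M : Type*} [CommRing R] [AddCommGroup M] [Module R M]
    {B : LinearMap.BilinForm R M} (hB : B.IsAlt) : ExteriorAlgebra R M →ₗ[R] R :=
  ExteriorAlgebra.algebraMapInv.toLinearMap ∘ₗ
    CliffordAlgebra.changeForm (Q := 0) (Q' := 0) (B := -B)
      (by ext x; simp [hB.self_eq_zero])

/-- The recursion of the change of form, `ι x * y ↦ ι x * y' - (-B x) ⌋ y'`, is the expansion of the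
Pfaffian along the first row once the scalar part is taken. -/
theorem wickFunctional_ιMulti {R M : Type*} [CommRing R] [AddCommGroup M] [Module R M]
    {B : LinearMap.BilinForm R M} (hB : B.IsAlt) (n : ℕ) (v : Fin (2 * n) → M) :
    wickFunctional hB (ExteriorAlgebra.ιMulti R (2 * n) v) =
      pfaffian n (Matrix.of fun i j => B (v i) (v j)) := by
  induction n with
  | zero =>
    have : ExteriorAlgebra.ιMulti R (2 * 0) v = 1 := ExteriorAlgebra.ιMulti_zero_apply v
    rw [this]
    simp only [wickFunctional, pfaffian, LinearMap.comp_apply]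
    erw [CliffordAlgebra.changeForm_one]
    simp
  | succ n ih =>
    have key : ∀ (x : M) (y : ExteriorAlgebra R M),
        wickFunctional hB (ExteriorAlgebra.ι R x * y) =
          wickFunctional hB (CliffordAlgebra.contractLeft (Q := 0) (B x) y) := by
      intro x y
      simp only [wickFunctional, LinearMap.comp_apply]
      erw [CliffordAlgebra.changeForm_ι_mul, CliffordAlgebra.changeForm_contractLeft]
      rw [map_sub]
      -- left multiples of a vector have no scalar part
      have : ∀ z, (ExteriorAlgebra.algebraMapInv (R := R) (M := M)).toLinearMap
          (CliffordAlgebra.ι 0 x * z) = 0 := by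
        intro z
        change ExteriorAlgebra.algebraMapInv (ExteriorAlgebra.ι R x * z) = 0
        rw [map_mul]
        simp [ExteriorAlgebra.algebraMapInv]
      erw [this]
      simp
    have h1 := ExteriorAlgebra.ιMulti_succ_apply (R := R) (n := 2 * n + 1) v
    rw [show ExteriorAlgebra.ιMulti R (2 * (n + 1)) v = _ from h1, key]
    rw [contractLeft_ιMulti_succ, map_sum, pfaffian]
    refine Finset.sum_congr rfl fun j _ => ?_
    rw [map_smul, ih, smul_eq_mul]
    rfl

/-! ### The square of the Pfaffian -/

theorem pfaffian_map {R S : Type*} [CommRing R] [CommRing S] (f : R →+* S) (n : ℕ)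
    (A : Matrix (Fin (2 * n)) (Fin (2 * n)) R) :
    pfaffian n (A.map f) = f (pfaffian n A) := by
  induction n with
  | zero => simp [pfaffian]
  | succ n ih =>
    simp only [pfaffian, map_sum, map_mul, map_pow, map_neg, map_one, ← ih]
    rfl

/-- The Pfaffian of the Gram matrix is alternating in the vectors, hence is a multiple of the
determinant relative to a basis. -/
theorem pfaffian_gram {R M : Type*} [CommRing R] [AddCommGroup M] [Module R M]
    {B : LinearMap.BilinForm R M} (hB : B.IsAlt) (n : ℕ) (e : Module.Basis (Fin (2 * n)) R M)
    (v : Fin (2 * n) → M) :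
    pfaffian n (Matrix.of fun i j => B (v i) (v j)) =
      e.det v * pfaffian n (Matrix.of fun i j => B (e i) (e j)) := by
  have h := AlternatingMap.eq_smul_basis_det e
    ((wickFunctional hB).compAlternatingMap (ExteriorAlgebra.ιMulti R (2 * n)))
  have h2 := congrArg (fun f => f v) h
  simp only [LinearMap.compAlternatingMap_apply, AlternatingMap.smul_apply, smul_eq_mul,
    wickFunctional_ιMulti] at h2
  rw [h2, mul_comm]

theorem det_gram {R M ι : Type*} [Fintype ι] [DecidableEq ι] [CommRing R] [AddCommGroup M]
    [Module R M] (B : LinearMap.BilinForm R M) (e : Module.Basis ι R M) (v : ι → M) :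
    (Matrix.of fun i j => B (v i) (v j)).det =
      e.det v ^ 2 * (Matrix.of fun i j => B (e i) (e j)).det := by
  have : (Matrix.of fun i j => B (v i) (v j)) =
      (e.toMatrix v).transpose * (Matrix.of fun i j => B (e i) (e j)) * e.toMatrix v := by
    ext i j
    simp only [Matrix.mul_apply, Matrix.of_apply, Matrix.transpose_apply, Finset.sum_mul]
    conv_lhs => rw [← e.sum_toMatrix_smul_self v i, ← e.sum_toMatrix_smul_self v j]
    simp only [map_sum, map_smul, LinearMap.sum_apply, LinearMap.smul_apply, smul_eq_mul,
      Finset.mul_sum]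
    refine Finset.sum_congr rfl fun k _ => Finset.sum_congr rfl fun l _ => ?_
    ring
  rw [this, Matrix.det_mul, Matrix.det_mul, Matrix.det_transpose, Module.Basis.det_apply]
  ring

/-- The Gram matrix of a symplectic basis in the order `(e₁, f₁, …, eₙ, fₙ)`: the indices `2 i` and
`2 i + 1` are paired. -/
def standardGram (R : Type*) [CommRing R] (n : ℕ) : Matrix (Fin (2 * n)) (Fin (2 * n)) R :=
  Matrix.of fun i j => if (i : ℕ) / 2 = j / 2 then
    (if (i : ℕ) < j then 1 else if (j : ℕ) < i then -1 else 0) else 0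

theorem pfaffian_standardGram (R : Type*) [CommRing R] (n : ℕ) :
    pfaffian n (standardGram R n) = 1 := by
  induction n with
  | zero => rfl
  | succ n ih =>
    rw [pfaffian, Finset.sum_eq_single 0]
    · convert ih using 1
      rw [show standardGram R (n + 1) 0 (Fin.succ 0) = 1 from
        (if_pos (show 0 / 2 = (0 + 1) / 2 by rfl)).trans (if_pos (show 0 < 0 + 1 by omega))]
      simp only [Fin.val_zero, pow_zero, one_mul]
      congr 1
      ext i j
      simp only [standardGram, Matrix.submatrix_apply, Matrix.of_apply, Fin.zero_succAbove,
        Fin.val_succ, add_lt_add_iff_right]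
      congr 1
      simp only [eq_iff_iff]
      omega
    · intro j _ hj
      have hj' : (j : ℕ) ≠ 0 := fun h => hj (Fin.ext h)
      have : standardGram R (n + 1) 0 j.succ = 0 := by
        simp only [standardGram, Matrix.of_apply, Fin.val_succ]
        rw [if_neg]
        show ¬ (0 / 2 = _)
        omega
      rw [this]; simp
    · simp

theorem det_standardGram (R : Type*) [CommRing R] (n : ℕ) : (standardGram R n).det = 1 := by
  -- in this order of the indices the matrix is block diagonal with blocks of order `2`
  let e : Fin 2 × Fin n ≃ Fin (2 * n) :=
    (Equiv.prodComm _ _).trans (finProdFinEquiv.trans (finCongr (mul_comm n 2)))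
  have : (standardGram R n).submatrix e e =
      Matrix.blockDiagonal fun _ : Fin n => !![0, 1; -1, 0] := by
    ext ⟨i, a⟩ ⟨j, b⟩
    have h : ∀ (i : Fin 2) (a : Fin n), ((e (i, a) : Fin (2 * n)) : ℕ) = i + 2 * a := by
      intro i a; simp [e, finProdFinEquiv]
    simp only [standardGram, Matrix.submatrix_apply, Matrix.of_apply, h,
      Matrix.blockDiagonal_apply]
    have : ((i : ℕ) + 2 * a) / 2 = (j + 2 * b) / 2 ↔ a = b := by
      rw [Fin.ext_iff]; omega
    simp only [this]
    by_cases hab : a = b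
    · subst hab
      fin_cases i <;> fin_cases j <;> simp
    · simp [hab]
  rw [← Matrix.det_submatrix_equiv_self e, this, Matrix.det_blockDiagonal]
  simp [Matrix.det_fin_two]

theorem IsSymplecticBasis.gram_interleave {K V : Type*} [Field K] [AddCommGroup V] [Module K V]
    {ω : LinearMap.BilinForm K V} (hω : ω.IsAlt) {n : ℕ}
    {b : Module.Basis (Fin n ⊕ Fin n) K V} (hb : IsSymplecticBasis ω b) :
    (Matrix.of fun i j => ω (interleave b i) (interleave b j)) = standardGram K n := by
  ext i j
  have h4 : ∀ i j, ω (b (Sum.inr i)) (b (Sum.inl j)) = - if i = j then 1 else 0 := by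
    intro i j
    rw [← hω.neg_eq, hb.inl_inr]
    simp [eq_comm]
  simp only [Matrix.of_apply, interleave, standardGram]
  split_ifs <;>
    simp only [hb.inl_inl, hb.inl_inr, hb.inr_inr, Fin.mk.injEq, if_true, if_false, neg_zero,
      *] <;>
    omega

/-- The bijection of indices behind `interleave`: `eᵢ` has position `2 i` and `fᵢ` has position
`2 i + 1`. -/
def interleaveEquiv (n : ℕ) : Fin n ⊕ Fin n ≃ Fin (2 * n) where
  toFun := Sum.elim (fun i => ⟨2 * i, by omega⟩) (fun i => ⟨2 * i + 1, by omega⟩)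
  invFun := interleave id
  left_inv := by
    rintro (i | i)
    · simp [interleave]
    · simp [interleave, Fin.ext_iff]
      omega
  right_inv := by
    intro i
    ext
    simp only [interleave]
    split_ifs <;> simp <;> omega

theorem interleave_eq_reindex {K V : Type*} [Field K] [AddCommGroup V] [Module K V] {n : ℕ}
    (b : Module.Basis (Fin n ⊕ Fin n) K V) :
    interleave b = b.reindex (interleaveEquiv n) := by
  ext i
  simp only [Module.Basis.reindex_apply, interleaveEquiv, Equiv.coe_fn_symm_mk, interleave]
  split_ifs <;> rfl

/-- Passing to a symplectic basis multiplies both sides by the same square. -/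
theorem pfaffian_sq_of_nondegenerate {K V : Type*} [Field K] [AddCommGroup V] [Module K V]
    {B : LinearMap.BilinForm K V} (hB : IsSymplectic B) (n : ℕ)
    (v : Module.Basis (Fin (2 * n)) K V) :
    pfaffian n (Matrix.of fun i j => B (v i) (v j)) ^ 2 =
      (Matrix.of fun i j => B (v i) (v j)).det := by
  have := Module.Finite.of_basis v
  obtain ⟨m, b, hb⟩ := hB.exists_basis
  obtain rfl : n = m := by
    have h1 := Module.finrank_eq_card_basis v
    have h2 := Module.finrank_eq_card_basis b
    simp at h1 h2
    omega
  have hg := hb.gram_interleave hB.isAlt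
  rw [interleave_eq_reindex] at hg
  rw [pfaffian_gram hB.isAlt n (b.reindex (interleaveEquiv n)),
    det_gram B (b.reindex (interleaveEquiv n)), hg, pfaffian_standardGram, det_standardGram,
    mul_one, mul_one]

/-- `Pf² = det` for an alternating matrix over a domain. The determinant is assumed non-zero, so
that the form over the fraction field is symplectic and has a symplectic basis. -/
theorem pfaffian_sq {R : Type*} [CommRing R] [IsDomain R] (n : ℕ)
    (A : Matrix (Fin (2 * n)) (Fin (2 * n)) R) (hdiag : ∀ i, A i i = 0)
    (hskew : ∀ i j, A i j + A j i = 0) (hdet : A.det ≠ 0) :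
    pfaffian n A ^ 2 = A.det := by
  let F := FractionRing R
  let f := algebraMap R F
  have hinj : Function.Injective f := IsFractionRing.injective R F
  let B : LinearMap.BilinForm F (Fin (2 * n) → F) := Matrix.toBilin' (A.map f)
  let v := Pi.basisFun F (Fin (2 * n))
  have hBv : (Matrix.of fun i j => B (v i) (v j)) = A.map f := by
    ext i j
    simp [B, v, Matrix.toBilin'_single]
  have hmat : LinearMap.BilinForm.toMatrix v B = A.map f := by
    rw [← hBv]; ext i j; simp [LinearMap.BilinForm.toMatrix_apply]
  have hB : IsSymplectic B := by
    refine ⟨fun x => ?_, ?_⟩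
    · rw [show B x x = ∑ p : Fin (2 * n) × Fin (2 * n), x p.1 * f (A p.1 p.2) * x p.2 by
        simp [B, Matrix.toBilin'_apply, Fintype.sum_prod_type]]
      -- the terms of index `(i, j)` and `(j, i)` cancel, which also covers characteristic `2`
      refine Finset.sum_involution (fun p _ => p.swap) ?_ ?_ (by simp) (by simp)
      · rintro ⟨i, j⟩ -
        have : f (A i j) + f (A j i) = 0 := by rw [← map_add, hskew, map_zero]
        simp only [Prod.swap]
        linear_combination x i * x j * this
      · rintro ⟨i, j⟩ - h h'
        obtain rfl : j = i := (Prod.ext_iff.mp h').1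
        simp [hdiag] at h
    · rw [LinearMap.BilinForm.nondegenerate_iff_det_ne_zero (b := v), hmat,
        ← RingHom.mapMatrix_apply, ← RingHom.map_det]
      simpa using fun h => hdet (hinj (by simpa using h))
  have h := pfaffian_sq_of_nondegenerate hB n v
  rw [hBv, pfaffian_map, ← RingHom.mapMatrix_apply, ← RingHom.map_det, ← map_pow] at h
  exact hinj h

/-! ### The symplectic characteristic polynomial and the characteristic polynomial -/

theorem rootPoly_sq {K V : Type*} [Field K] [AddCommGroup V] [Module K V] [FiniteDimensional K V]
    {ω : LinearMap.BilinForm K V} (hω : IsSymplectic ω) (A : Module.End K V)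
    (hA : ∀ v, ω v (A v) = 0) : rootPoly hω A ^ 2 = A.charpoly := by
  rw [rootPoly]
  set n := hω.exists_basis.choose
  set b := hω.exists_basis.choose_spec.choose
  have hb : IsSymplecticBasis ω b := hω.exists_basis.choose_spec.choose_spec
  have hg := hb.gram_interleave hω.isAlt
  let e := b.reindex (interleaveEquiv n)
  have he : interleave b = e := interleave_eq_reindex b
  rw [he] at hg
  simp only [he]
  set P : Matrix (Fin (2 * n)) (Fin (2 * n)) (Polynomial K) := Matrix.of fun i j =>
    Polynomial.C (ω (e i) (A (e j))) - Polynomial.X * Polynomial.C (ω (e i) (e j)) with hP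
  -- the matrix of `ω_{A - tE}` is the Gram matrix of `ω` times the matrix of `A - tE`
  have hfac : P = - ((standardGram K n).map Polynomial.C *
      (LinearMap.toMatrix e e A).charmatrix) := by
    have h1 : (Matrix.of fun i j => ω (e i) (A (e j))) =
        standardGram K n * LinearMap.toMatrix e e A := by
      ext i j
      rw [← hg, Matrix.mul_apply, Matrix.of_apply]
      conv_lhs => rw [← e.sum_repr (A (e j))]
      simp only [map_sum, map_smul, smul_eq_mul, LinearMap.toMatrix_apply, Matrix.of_apply]
      exact Finset.sum_congr rfl fun k _ => mul_comm _ _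
    rw [Matrix.charmatrix, mul_sub, neg_sub, RingHom.mapMatrix_apply, ← Matrix.map_mul, ← h1,
      ← hg]
    ext1 i j
    rw [Matrix.sub_apply, Matrix.scalar_apply, Matrix.mul_diagonal]
    simp only [hP, Matrix.of_apply, Matrix.map_apply]
    ring
  have hdet : P.det = A.charpoly := by
    rw [hfac, Matrix.det_neg, Matrix.det_mul, ← RingHom.mapMatrix_apply, ← RingHom.map_det,
      det_standardGram, ← LinearMap.charpoly_toMatrix A e, Matrix.charpoly]
    simp
  have hpol : ∀ v w, ω v (A w) + ω w (A v) = 0 := by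
    intro v w
    have := hA (v + w)
    simp only [map_add, LinearMap.add_apply, hA] at this
    linear_combination this
  rw [← hdet]
  apply pfaffian_sq
  · intro i
    simp [hP, hA, hω.isAlt.self_eq_zero]
  · intro i j
    have h1 := hpol (e i) (e j)
    have h2 : ω (e i) (e j) + ω (e j) (e i) = 0 := by
      rw [← hω.isAlt.neg_eq (e i) (e j)]; ring
    simp only [hP, Matrix.of_apply]
    have h1' := congrArg Polynomial.C h1
    have h2' := congrArg Polynomial.C h2
    simp only [map_add, map_zero] at h1' h2'
    linear_combination h1' - Polynomial.X * h2'
  · rw [hdet]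
    exact A.charpoly_monic.ne_zero

section

variable {K V : Type*} [Field K] [AddCommGroup V] [Module K V] [FiniteDimensional K V]
  {ω : LinearMap.BilinForm K V} (hω : IsSymplectic ω) (M : Module.End K V)

/-- `M` is in turn the adjoint of `M^{*ω}`. -/
theorem apply_eq_sympAdjoint_apply (v w : V) : ω v (M w) = ω (sympAdjoint hω M v) w := by
  rw [← neg_inj, hω.isAlt.neg_eq, hω.isAlt.neg_eq, apply_sympAdjoint]

theorem baseChange_sympAdjoint_apply (F : Type*) [Field F] [Algebra K F] (x y : F ⊗[K] V) :
    ω.baseChange F x (M.baseChange F y) = ω.baseChange F ((sympAdjoint hω M).baseChange F x) y := by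
  induction x using TensorProduct.induction_on with
  | zero => simp
  | add x x' hx hx' => simp only [map_add, LinearMap.add_apply, hx, hx']
  | tmul a v =>
    induction y using TensorProduct.induction_on with
    | zero => simp
    | add y y' hy hy' => simp only [map_add, hy, hy']
    | tmul c w => simp [apply_eq_sympAdjoint_apply hω M]

/-- `rootPoly_sq` applies because `ω(x, (M - s)(M^{*ω} - s) x) = ω(y, y)` with
`y = (M^{*ω} - s) x`. -/
theorem sympCharPoly_sq : sympCharPoly hω M ^ 2 = (shiftedProduct hω M).charpoly := by
  refine rootPoly_sq _ _ fun v => ?_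
  have halt := (hω.baseChange (RatFunc K)).isAlt
  have : ∀ x y, ω.baseChange (RatFunc K) x
      ((M.baseChange (RatFunc K) - (RatFunc.X : RatFunc K) • 1) y) =
      ω.baseChange (RatFunc K)
        (((sympAdjoint hω M).baseChange (RatFunc K) - (RatFunc.X : RatFunc K) • 1) x) y := by
    intro x y
    simp [baseChange_sympAdjoint_apply hω M]
  rw [shiftedProduct, Module.End.mul_apply, this, halt.self_eq_zero]

end

theorem det_baseChange_sub_X {K V : Type*} [Field K] [AddCommGroup V] [Module K V]
    [FiniteDimensional K V] (M : Module.End K V) :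
    LinearMap.det (M.baseChange (RatFunc K) - (RatFunc.X : RatFunc K) • 1) =
      (-1) ^ Module.finrank K V * algebraMap (Polynomial K) (RatFunc K) M.charpoly := by
  have h := LinearMap.eval_charpoly (M.baseChange (RatFunc K)) RatFunc.X
  have h1 : (M.baseChange (RatFunc K) - (RatFunc.X : RatFunc K) • 1) =
      -(algebraMap (RatFunc K) (Module.End (RatFunc K) (RatFunc K ⊗[K] V)) RatFunc.X -
        M.baseChange (RatFunc K)) := by
    rw [neg_sub]; rfl
  rw [h1, ← neg_one_smul (RatFunc K), LinearMap.det_smul, ← h, LinearMap.charpoly_baseChange,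
    Polynomial.eval_map_algebraMap, Module.finrank_baseChange, ← RatFunc.algebraMap_X,
    Polynomial.aeval_algebraMap_apply, Polynomial.aeval_X_left_apply]

/-! ### Generalized eigenspaces -/

theorem iSup_maxGenEigenspace_eq_top_of_splits {K V : Type*} [Field K] [AddCommGroup V]
    [Module K V] [FiniteDimensional K V] (M : Module.End K V) (h : M.charpoly.Splits) :
    ⨆ a, M.maxGenEigenspace a = ⊤ := by
  classical
  -- coprime factors of the characteristic polynomial split the kernel
  have key : ∀ (s : Finset K) (n : K → ℕ),
      LinearMap.ker (Polynomial.aeval M (∏ a ∈ s, (Polynomial.X - Polynomial.C a) ^ n a)) ≤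
        ⨆ a, M.maxGenEigenspace a := by
    intro s n
    induction s using Finset.induction_on with
    | empty => simp [Module.End.one_eq_id]
    | insert a s ha ih =>
      rw [Finset.prod_insert ha, ← Polynomial.sup_ker_aeval_eq_ker_aeval_mul_of_coprime]
      · refine sup_le ?_ ih
        refine le_trans ?_ (le_iSup _ a)
        intro x hx
        rw [Module.End.mem_maxGenEigenspace]
        refine ⟨n a, ?_⟩
        simpa [Algebra.algebraMap_eq_smul_one] using hx
      · refine IsCoprime.prod_right fun b hb => IsCoprime.pow ?_
        refine Polynomial.isCoprime_X_sub_C_of_isUnit_sub (sub_ne_zero.mpr ?_).isUnit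
        rintro rfl
        exact ha hb
  rw [eq_top_iff]
  refine le_trans (fun x _ => ?_) (key M.charpoly.roots.toFinset (M.charpoly.roots.count ·))
  have := h.eq_prod_roots_of_monic M.charpoly_monic
  rw [Finset.prod_multiset_map_count] at this
  rw [← this, LinearMap.aeval_self_charpoly]
  simp

theorem maxGenEigenspace_inf_le_mul {K V : Type*} [CommRing K] [AddCommGroup V]
    [Module K V] {f g : Module.End K V} (h : Commute f g) (a b : K) :
    f.maxGenEigenspace a ⊓ g.maxGenEigenspace b ≤ (f * g).maxGenEigenspace (a * b) := by
  rintro x ⟨hx, hy⟩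
  rw [SetLike.mem_coe, Module.End.mem_maxGenEigenspace] at hx hy
  obtain ⟨k, hk⟩ := hx
  obtain ⟨l, hl⟩ := hy
  have hfg : Commute (f - a • 1) g := h.sub_left (Algebra.commute_algebraMap_left a g)
  -- `f * g = (f - a) * g + a • g`, where the first summand is nilpotent at `x`
  have h1 : x ∈ ((f - a • 1) * g).maxGenEigenspace 0 := by
    rw [Module.End.mem_maxGenEigenspace]
    refine ⟨k, ?_⟩
    rw [zero_smul, sub_zero, hfg.eq, hfg.symm.mul_pow, Module.End.mul_apply, hk, map_zero]
  have h2 : x ∈ (a • g).maxGenEigenspace (a * b) :=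
    Module.End.genEigenspace_le_smul g b a ⊤
      ((Module.End.mem_maxGenEigenspace g b x).mpr ⟨l, hl⟩)
  have hc : Commute ((f - a • 1) * g) (a • g) :=
    ((hfg.mul_left (Commute.refl g)).smul_right a)
  have h3 := Module.End.genEigenspace_inf_le_add _ _ 0 (a * b) ⊤ ⊤ hc ⟨h1, h2⟩
  have h4 : (f - a • 1) * g + a • g = f * g := by
    rw [sub_mul, smul_mul_assoc, one_mul, sub_add_cancel]
  rwa [h4, zero_add, top_add] at h3

section

variable {K : Type*} [Field K] {V : Type*} [AddCommGroup V] [Module K V]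

/-- The root `(a - s)(b - s)` determines the unordered pair `{a, b}`. -/
theorem pair_eq_of_shifted_mul_eq {a b c d : K}
    (h : (RatFunc.C a - RatFunc.X) * (RatFunc.C b - RatFunc.X) =
      (RatFunc.C c - RatFunc.X) * (RatFunc.C d - RatFunc.X)) :
    (a = c ∧ b = d) ∨ (a = d ∧ b = c) := by
  have h1 : (Polynomial.C a - Polynomial.X) * (Polynomial.C b - Polynomial.X) =
      (Polynomial.C c - Polynomial.X) * (Polynomial.C d - Polynomial.X) := by
    apply RatFunc.algebraMap_injective K
    simpa [RatFunc.algebraMap_C, RatFunc.algebraMap_X] using h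
  -- `s = c` shows that `c` is `a` or `b`, and `s = 0, 1` together give `a + b = c + d`
  have h2 := congrArg (Polynomial.eval c) h1
  have h3 := congrArg (Polynomial.eval 0) h1
  have h4 := congrArg (Polynomial.eval 1) h1
  simp only [Polynomial.eval_mul, Polynomial.eval_sub, Polynomial.eval_C, Polynomial.eval_X,
    sub_self, zero_mul, mul_eq_zero, sub_eq_zero] at h2 h3 h4
  have hsum : a + b = c + d := by linear_combination h3 - h4
  rcases h2 with rfl | rfl
  · exact Or.inl ⟨rfl, by linear_combination hsum⟩
  · exact Or.inr ⟨by linear_combination hsum, rfl⟩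

/-! ### Generalized eigenspaces over the field of rational functions -/

theorem commute_baseChange_sub {M N : Module.End K V} (h : Commute M N) (F : Type*) [Field F]
    [Algebra K F] (x : F) :
    Commute (M.baseChange F - x • 1 : Module.End F (F ⊗[K] V)) (N.baseChange F - x • 1) := by
  have h1 : Commute (M.baseChange F : Module.End F (F ⊗[K] V)) (N.baseChange F) := by
    rw [Commute, SemiconjBy, ← LinearMap.baseChange_mul, h.eq, LinearMap.baseChange_mul]
  have h2 : ∀ {A : Type _} [Ring A] [Algebra F A] (f g : A), Commute f g →
      Commute (f - x • 1) (g - x • 1) := fun f g hfg => by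
    rw [← Algebra.algebraMap_eq_smul_one]
    exact (hfg.sub_right (Algebra.commute_algebraMap_right x f)).sub_left
      (Algebra.commute_algebraMap_left x _)
  exact h2 (A := Module.End F (F ⊗[K] V)) _ _ h1

theorem tmul_mem_maxGenEigenspace_baseChange_sub {M : Module.End K V} {F : Type*} [Field F]
    [Algebra K F] {a : K} {v : V} (hv : v ∈ M.maxGenEigenspace a) (c x : F) :
    c ⊗ₜ[K] v ∈
      Module.End.maxGenEigenspace (M.baseChange F - x • 1) (algebraMap K F a - x) := by
  rw [Module.End.mem_maxGenEigenspace] at hv ⊢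
  obtain ⟨k, hk⟩ := hv
  refine ⟨k, ?_⟩
  have : (M.baseChange F - x • 1 : Module.End F (F ⊗[K] V)) - (algebraMap K F a - x) • 1 =
      (M - a • 1).baseChange F := by
    rw [LinearMap.baseChange_sub, LinearMap.baseChange_smul, LinearMap.baseChange_one,
      ← algebraMap_smul F a (1 : Module.End F (F ⊗[K] V))]
    module
  rw [this, ← LinearMap.baseChange_pow, LinearMap.baseChange_tmul, hk, TensorProduct.tmul_zero]

theorem tmul_mem_maxGenEigenspace_shiftedProduct [FiniteDimensional K V]
    {ω : LinearMap.BilinForm K V}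
    (hω : IsSymplectic ω) {M : Module.End K V} (hM : Commute M (sympAdjoint hω M)) {a b : K}
    {v : V} (hv : v ∈ M.maxGenEigenspace a ⊓ (sympAdjoint hω M).maxGenEigenspace b)
    (c : RatFunc K) :
    c ⊗ₜ[K] v ∈ (shiftedProduct hω M).maxGenEigenspace
      ((RatFunc.C a - RatFunc.X) * (RatFunc.C b - RatFunc.X)) :=
  maxGenEigenspace_inf_le_mul (commute_baseChange_sub hM (RatFunc K) RatFunc.X) _ _
    ⟨tmul_mem_maxGenEigenspace_baseChange_sub hv.1 c _,
      tmul_mem_maxGenEigenspace_baseChange_sub hv.2 c _⟩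

theorem pairGenEigenspace_eq [FiniteDimensional K V] (M N : Module.End K V) (a b : K) :
    pairGenEigenspace M N a b = (M.maxGenEigenspace a ⊓ N.maxGenEigenspace b) ⊔
      (M.maxGenEigenspace b ⊓ N.maxGenEigenspace a) := by
  simp only [pairGenEigenspace, Module.End.maxGenEigenspace_eq_genEigenspace_finrank]

/-- The extension of `G_{M, M^{*ω}}(a, b)` to `K(s)` lies in a generalized eigenspace of
`(M - s)(M^{*ω} - s)`, whose dimension is the algebraic multiplicity. -/
theorem finrank_pairGenEigenspace_le [FiniteDimensional K V] {ω : LinearMap.BilinForm K V}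
    (hω : IsSymplectic ω) {M : Module.End K V} (hM : Commute M (sympAdjoint hω M)) (a b : K) :
    Module.finrank K (pairGenEigenspace M (sympAdjoint hω M) a b) ≤
      (shiftedProduct hω M).charpoly.rootMultiplicity
        ((RatFunc.C a - RatFunc.X) * (RatFunc.C b - RatFunc.X)) := by
  set G := pairGenEigenspace M (sympAdjoint hω M) a b with hG
  have hmem : ∀ v ∈ G, ∀ c : RatFunc K, c ⊗ₜ[K] v ∈ (shiftedProduct hω M).maxGenEigenspace
      ((RatFunc.C a - RatFunc.X) * (RatFunc.C b - RatFunc.X)) := by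
    intro v hv c
    rw [hG, pairGenEigenspace_eq] at hv
    obtain ⟨x, hx, y, hy, rfl⟩ := Submodule.mem_sup.mp hv
    rw [TensorProduct.tmul_add]
    refine Submodule.add_mem _ (tmul_mem_maxGenEigenspace_shiftedProduct hω hM hx c) ?_
    rw [mul_comm]
    exact tmul_mem_maxGenEigenspace_shiftedProduct hω hM hy c
  rw [← LinearMap.finrank_maxGenEigenspace_eq, ← Module.finrank_baseChange (R := RatFunc K)]
  have hinj : Function.Injective (G.subtype.baseChange (RatFunc K)) :=
    Module.Flat.lTensor_preserves_injective_linearMap _ G.injective_subtype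
  rw [← LinearMap.finrank_range_of_inj hinj]
  apply Submodule.finrank_mono
  rintro _ ⟨x, rfl⟩
  induction x using TensorProduct.induction_on with
  | zero => simp
  | add x y hx hy => rw [map_add]; exact Submodule.add_mem _ hx hy
  | tmul c v => exact hmem v v.2 c

theorem isRoot_charpoly_shiftedProduct [FiniteDimensional K V] {ω : LinearMap.BilinForm K V}
    (hω : IsSymplectic ω) {M : Module.End K V} (hM : Commute M (sympAdjoint hω M)) {a b : K}
    (h : M.maxGenEigenspace a ⊓ (sympAdjoint hω M).maxGenEigenspace b ≠ ⊥) :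
    (shiftedProduct hω M).charpoly.IsRoot
      ((RatFunc.C a - RatFunc.X) * (RatFunc.C b - RatFunc.X)) := by
  rw [← Polynomial.rootMultiplicity_pos (LinearMap.charpoly_monic _).ne_zero]
  refine lt_of_lt_of_le ?_ (finrank_pairGenEigenspace_le hω hM a b)
  have h1 := Submodule.one_le_finrank_iff.mpr h
  refine lt_of_lt_of_le h1 (Submodule.finrank_mono ?_)
  rw [pairGenEigenspace_eq]
  exact le_sup_left

theorem iSup_maxGenEigenspace_inf_eq_top [FiniteDimensional K V] {M N : Module.End K V}
    (h : Commute M N)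
    (hM : M.charpoly.Splits) (hN : N.charpoly.Splits) :
    ⨆ p : K × K, M.maxGenEigenspace p.1 ⊓ N.maxGenEigenspace p.2 = ⊤ := by
  have := Module.End.iSup_iInf_maxGenEigenspace_eq_top_of_iSup_maxGenEigenspace_eq_top_of_commute
    ![M, N] (by
      intro i j hij
      fin_cases i <;> fin_cases j <;> first | exact absurd rfl hij | exact h | exact h.symm)
    (by
      intro i
      fin_cases i
      · exact iSup_maxGenEigenspace_eq_top_of_splits M hM
      · exact iSup_maxGenEigenspace_eq_top_of_splits N hN)
  rw [eq_top_iff, ← this]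
  refine iSup_le fun χ => le_trans ?_ (le_iSup _ (χ 0, χ 1))
  exact le_inf (iInf_le _ 0) (iInf_le _ 1)

/-! ### Orthogonality -/

/-- For adjoint `M` and `N`, generalized eigenvectors for different eigenvalues are orthogonal. -/
theorem apply_eq_zero_of_mem_maxGenEigenspace {ω : LinearMap.BilinForm K V}
    {M N : Module.End K V} (h : ∀ v w, ω (M v) w = ω v (N w)) {a b : K} (hab : a ≠ b) {v w : V}
    (hv : v ∈ M.maxGenEigenspace a) (hw : w ∈ N.maxGenEigenspace b) : ω v w = 0 := by
  rw [Module.End.mem_maxGenEigenspace] at hv hw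
  obtain ⟨k, hk⟩ := hv
  obtain ⟨l, hl⟩ := hw
  -- `(a - b) ω(v, w) = ω(v, (N - b) w) - ω((M - a) v, w)`, where both terms have smaller exponents
  induction hn : k + l using Nat.strong_induction_on generalizing v w k l with
  | _ n ih =>
  match k, l with
  | 0, _ => rw [pow_zero] at hk; simp [show v = 0 from hk]
  | _, 0 => rw [pow_zero] at hl; simp [show w = 0 from hl]
  | k + 1, l + 1 =>
    rw [pow_succ, Module.End.mul_apply] at hk
    have hl' := hl
    rw [pow_succ, Module.End.mul_apply] at hl
    have h1 := ih (k + (l + 1)) (by omega) k hk (l + 1) hl' rfl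
    have h2 : ω v ((N - b • 1) w) = 0 := by
      refine ih (k + 1 + l) (by omega) (k + 1) ?_ l hl rfl
      rw [pow_succ, Module.End.mul_apply, hk]
    simp only [LinearMap.sub_apply, LinearMap.smul_apply, Module.End.one_apply, map_sub, map_smul,
      smul_eq_mul, h] at h1 h2
    have : (a - b) * ω v w = 0 := by linear_combination h2 - h1
    exact (mul_eq_zero.mp this).resolve_left (sub_ne_zero.mpr hab)

theorem pairGenEigenspace_le_sympOrthogonal [FiniteDimensional K V] {ω : LinearMap.BilinForm K V}
    (hω : IsSymplectic ω) (M : Module.End K V) {a b c d : K}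
    (h : ¬((a = c ∧ b = d) ∨ (a = d ∧ b = c))) :
    pairGenEigenspace M (sympAdjoint hω M) a b ≤
      sympOrthogonal ω (pairGenEigenspace M (sympAdjoint hω M) c d) := by
  have key : ∀ {a b c d : K}, ¬(a = d ∧ b = c) → ∀ v w,
      v ∈ M.maxGenEigenspace a ⊓ (sympAdjoint hω M).maxGenEigenspace b →
      w ∈ M.maxGenEigenspace c ⊓ (sympAdjoint hω M).maxGenEigenspace d → ω v w = 0 := by
    intro a b c d h v w hv hw
    by_cases had : a = d
    · exact apply_eq_zero_of_mem_maxGenEigenspace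
        (fun v w => (apply_eq_sympAdjoint_apply hω M v w).symm) (fun hbc => h ⟨had, hbc⟩)
        hv.2 hw.1
    · exact apply_eq_zero_of_mem_maxGenEigenspace
        (fun v w => (apply_sympAdjoint hω M v w).symm) had hv.1 hw.2
  intro v hv w hw
  rw [pairGenEigenspace_eq] at hv
  rw [pairGenEigenspace_eq] at hw
  obtain ⟨v₁, hv₁, v₂, hv₂, rfl⟩ := Submodule.mem_sup.mp hv
  obtain ⟨w₁, hw₁, w₂, hw₂, rfl⟩ := Submodule.mem_sup.mp hw
  change ω (v₁ + v₂) (w₁ + w₂) = 0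
  rw [map_add, map_add, LinearMap.add_apply, LinearMap.add_apply,
    key (by tauto) _ _ hv₁ hw₁, key (by tauto) _ _ hv₁ hw₂, key (by tauto) _ _ hv₂ hw₁,
    key (by tauto) _ _ hv₂ hw₂]
  simp

theorem pairGenEigenspace_mem_invtSubmodule [FiniteDimensional K V] {M N f : Module.End K V}
    (hM : Commute M f)
    (hN : Commute N f) (a b : K) : pairGenEigenspace M N a b ∈ Module.End.invtSubmodule f := by
  rw [pairGenEigenspace_eq]
  have key : ∀ a b, M.maxGenEigenspace a ⊓ N.maxGenEigenspace b ∈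
      Module.End.invtSubmodule f := fun a b _ hx =>
    ⟨Module.End.mapsTo_maxGenEigenspace_of_comm hM a hx.1,
      Module.End.mapsTo_maxGenEigenspace_of_comm hN b hx.2⟩
  exact Sublattice.sup_mem (key a b) (key b a)

/-- A vector of `G i` orthogonal to `G i` is orthogonal to all of `V`. -/
theorem isSymplecticSubspace_of_iSup_eq_top {ω : LinearMap.BilinForm K V}
    (hω : IsSymplectic ω) {ι : Type*} {G : ι → Submodule K V} (htop : ⨆ i, G i = ⊤)
    (horth : ∀ i j, i ≠ j → G i ≤ sympOrthogonal ω (G j)) (i : ι) :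
    IsSymplecticSubspace ω (G i) := by
  rw [IsSymplecticSubspace, eq_bot_iff]
  rintro v ⟨hv, hv'⟩
  refine (Submodule.mem_bot K).mpr (hω.nondegenerate.1 v fun w => ?_)
  have : (⊤ : Submodule K V) ≤ LinearMap.ker (ω v) := by
    rw [← htop]
    refine iSup_le fun j w hw => ?_
    rcases eq_or_ne i j with rfl | hij
    · exact hv' w hw
    · exact horth i j hij hv w hw
  exact this trivial

theorem iSupIndep_of_isSymplecticSubspace {ω : LinearMap.BilinForm K V}
    {ι : Type*} {G : ι → Submodule K V}
    (horth : ∀ i j, i ≠ j → G i ≤ sympOrthogonal ω (G j))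
    (hG : ∀ i, IsSymplecticSubspace ω (G i)) : iSupIndep G := by
  intro i
  refine (disjoint_iff.mpr (hG i)).mono_right (iSup₂_le fun j hj => horth j i hj)

/-! ### The decomposition -/

/-- The value of `χ^ω_M(s, t)²` at `t = 0` is `det (M - s) det (M^{*ω} - s)`. The signs disappear
because `dim V` is even. -/
theorem charpoly_mul_charpoly_sympAdjoint [FiniteDimensional K V] {ω : LinearMap.BilinForm K V}
    (hω : IsSymplectic ω) (M : Module.End K V) :
    algebraMap (Polynomial K) (RatFunc K) (M.charpoly * (sympAdjoint hω M).charpoly) =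
      (sympCharPoly hω M).eval 0 ^ 2 := by
  have h := LinearMap.det_eq_sign_charpoly_coeff (shiftedProduct hω M)
  obtain ⟨n, b, -⟩ := hω.exists_basis
  have heven : Even (Module.finrank K V) := by
    rw [Module.finrank_eq_card_basis b]; simp
  rw [← sympCharPoly_sq, Module.finrank_baseChange, heven.neg_one_pow, shiftedProduct, map_mul,
    det_baseChange_sub_X, det_baseChange_sub_X, heven.neg_one_pow,
    Polynomial.coeff_zero_eq_eval_zero, Polynomial.eval_pow] at h
  rw [map_mul]
  linear_combination h

end

end SymplecticCharPoly

open SymplecticCharPoly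
theorem mainTheorem3 {K : Type*} [Field K] {V : Type*} [AddCommGroup V] [Module K V]
    [FiniteDimensional K V] (ω : LinearMap.BilinForm K V) (hω : IsSymplectic ω)
    (M : Module.End K V) (hM : M * sympAdjoint hω M = sympAdjoint hω M * M)
    (k : ℕ) (lam mu : Fin k → K) (m : Fin k → ℕ)
    (hchar : sympCharPoly hω M = ∏ i : Fin k,
      (Polynomial.C ((RatFunc.C (lam i) - RatFunc.X) * (RatFunc.C (mu i) - RatFunc.X))
        - Polynomial.X) ^ m i)
    (hdistinct : ∀ i j : Fin k, i ≠ j →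
      (RatFunc.C (lam i) - RatFunc.X) * (RatFunc.C (mu i) - RatFunc.X) ≠
        (RatFunc.C (lam j) - RatFunc.X) * (RatFunc.C (mu j) - RatFunc.X)) :
    (∀ i : Fin k,
      Module.finrank K (pairGenEigenspace M (sympAdjoint hω M) (lam i) (mu i)) = 2 * m i) ∧
    DirectSum.IsInternal
      (fun i : Fin k => pairGenEigenspace M (sympAdjoint hω M) (lam i) (mu i)) ∧
    (∀ i j : Fin k, i ≠ j → pairGenEigenspace M (sympAdjoint hω M) (lam i) (mu i) ≤
      sympOrthogonal ω (pairGenEigenspace M (sympAdjoint hω M) (lam j) (mu j))) ∧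
    (∀ i : Fin k,
      pairGenEigenspace M (sympAdjoint hω M) (lam i) (mu i) ∈ Module.End.invtSubmodule M ∧
      pairGenEigenspace M (sympAdjoint hω M) (lam i) (mu i) ∈
        Module.End.invtSubmodule (sympAdjoint hω M) ∧
      IsSymplecticSubspace ω (pairGenEigenspace M (sympAdjoint hω M) (lam i) (mu i))) := by
  set N := sympAdjoint hω M
  have hMN : Commute M N := hM
  set r : Fin k → RatFunc K := fun i =>
    (RatFunc.C (lam i) - RatFunc.X) * (RatFunc.C (mu i) - RatFunc.X)
  set G : Fin k → Submodule K V := fun i => pairGenEigenspace M N (lam i) (mu i) with hG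
  have hrinj : Function.Injective r := fun i j hij => by
    by_contra hne
    exact hdistinct i j hne hij
  have hchar2 : (shiftedProduct hω M).charpoly =
      ∏ i, (Polynomial.X - Polynomial.C (r i)) ^ (2 * m i) := by
    rw [← sympCharPoly_sq, hchar, ← Finset.prod_pow]
    refine Finset.prod_congr rfl fun i _ => ?_
    rw [← pow_mul, Nat.mul_comm (m i), pow_mul, pow_mul, sub_sq_comm]
  -- the roots `r i` are distinct, so only the factor of index `i` contributes
  have hmult : ∀ i, (shiftedProduct hω M).charpoly.rootMultiplicity (r i) = 2 * m i := by
    intro i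
    classical
    rw [← Polynomial.count_roots, hchar2, Polynomial.roots_prod _ _
      (Finset.prod_ne_zero_iff.mpr fun i _ => pow_ne_zero _ (Polynomial.X_sub_C_ne_zero _)),
      Multiset.count_bind, Finset.sum_map_val]
    simp [Polynomial.roots_pow, Multiset.count_singleton, hrinj.eq_iff]
  have hdeg : Module.finrank K V = ∑ i, 2 * m i := by
    rw [← Module.finrank_baseChange (R := RatFunc K),
      ← LinearMap.charpoly_natDegree (shiftedProduct hω M), hchar2,
      Polynomial.natDegree_prod_of_monic _ _
        fun i _ => (Polynomial.monic_X_sub_C _).pow _]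
    simp
  have hsplit : (M.charpoly * N.charpoly).Splits := by
    have h := charpoly_mul_charpoly_sympAdjoint hω M
    have h2 : M.charpoly * N.charpoly = ∏ i, (((Polynomial.C (lam i) - Polynomial.X) *
        (Polynomial.C (mu i) - Polynomial.X)) ^ m i) ^ 2 := by
      apply RatFunc.algebraMap_injective K
      rw [h, hchar]
      simp [Polynomial.eval_prod, Finset.prod_pow, RatFunc.algebraMap_C, RatFunc.algebraMap_X]
    have h3 : ∀ a : K, (Polynomial.C a - Polynomial.X).Splits := fun a => by
      rw [← neg_sub]; exact (Polynomial.Splits.X_sub_C a).neg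
    rw [h2]
    exact Polynomial.Splits.prod fun i _ => (((h3 _).mul (h3 _)).pow _).pow _
  have hne : M.charpoly * N.charpoly ≠ 0 :=
    (M.charpoly_monic.mul N.charpoly_monic).ne_zero
  -- a non-zero `G_M(a) ∩ G_N(b)` gives a root `(a - s)(b - s)`, so it lies in some `G i`
  have htop : ⨆ i, G i = ⊤ := by
    rw [eq_top_iff, ← iSup_maxGenEigenspace_inf_eq_top hMN
      (hsplit.of_dvd hne (dvd_mul_right _ _)) (hsplit.of_dvd hne (dvd_mul_left _ _))]
    refine iSup_le fun ⟨a, b⟩ => ?_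
    by_cases hbot : M.maxGenEigenspace a ⊓ N.maxGenEigenspace b = ⊥
    · exact hbot.trans_le bot_le
    have hroot := isRoot_charpoly_shiftedProduct hω hMN hbot
    rw [hchar2, Polynomial.IsRoot, Polynomial.eval_prod, Finset.prod_eq_zero_iff] at hroot
    obtain ⟨i, -, hi⟩ := hroot
    rw [Polynomial.eval_pow, Polynomial.eval_sub, Polynomial.eval_X, Polynomial.eval_C] at hi
    have hi' := sub_eq_zero.mp (eq_zero_of_pow_eq_zero hi)
    refine le_trans ?_ (le_iSup G i)
    rw [hG]
    simp only [pairGenEigenspace_eq]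
    rcases pair_eq_of_shifted_mul_eq hi' with ⟨rfl, rfl⟩ | ⟨rfl, rfl⟩
    · exact le_sup_left
    · exact le_sup_right
  have horth : ∀ i j, i ≠ j → G i ≤ sympOrthogonal ω (G j) := by
    intro i j hij
    refine pairGenEigenspace_le_sympOrthogonal hω M ?_
    rintro (⟨h1, h2⟩ | ⟨h1, h2⟩)
    · exact hdistinct i j hij (by rw [h1, h2])
    · exact hdistinct i j hij (by rw [h1, h2, mul_comm])
  have hsymp := isSymplecticSubspace_of_iSup_eq_top hω htop horth
  have hint : DirectSum.IsInternal G :=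
    (DirectSum.isInternal_submodule_iff_iSupIndep_and_iSup_eq_top G).mpr
      ⟨iSupIndep_of_isSymplecticSubspace horth hsymp, htop⟩
  have hle : ∀ i, Module.finrank K (G i) ≤ 2 * m i := fun i =>
    (finrank_pairGenEigenspace_le hω hMN (lam i) (mu i)).trans_eq (hmult i)
  have hsum : ∑ i, Module.finrank K (G i) = ∑ i, 2 * m i := by
    rw [← hdeg, ← (LinearEquiv.ofBijective (DirectSum.coeLinearMap G) hint).finrank_eq,
      Module.finrank_directSum]
  refine ⟨fun i => ?_, hint, horth, fun i => ⟨?_, ?_, hsymp i⟩⟩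
  · exact (Finset.sum_eq_sum_iff_of_le fun i _ => hle i).mp hsum i (Finset.mem_univ i)
  · exact pairGenEigenspace_mem_invtSubmodule (Commute.refl M) hMN.symm _ _
  · exact pairGenEigenspace_mem_invtSubmodule hMN (Commute.refl N) _ _
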